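/- A CNF formula $F$ is a finite set of clauses, a clause being a finite set of literals over a countably infinite supply of variables. Its hypergraph has the variables occurring in $F$ as vertices and, for each clause, the set of variables of that clause as a hyperedge; its incidence graph is the bipartite graph on the variables and the clauses of $F$ in which a variable is adjacent to exactly the clauses in which it occurs. A class of CNF formulas has bounded incidence clique-width if there is a $k$ such that the incidence graphs of all its members have clique-width at most $k$. A join tree of a hypergraph is a (nonempty) tree whose nodes are the hyperedges such that, for each vertex $v$, the hyperedges containing $v$ induce a connected subgraph of the tree. A join path is a join tree that is a path. A disjoint branches decomposition is a join tree, rooted at some node, in which any two nodes on different branches (neither is an ancestor of the other) are disjoint as hyperedges. We say that a CNF formula has one of these if its hypergraph does. Then: 1. The class of CNF formulas with join paths has unbounded incidence clique-width. 2. Every CNF formula with a join path has a disjoint branches decomposition; hence the class of CNF formulas with disjoint branches decompositions has unbounded incidence clique-width as well. 3. For $n\ge 3$ let $C_n$ be the CNF formula with clauses $x_i\vee x_{i+1}$ for $0\le i<n$ (indices modulo $n$). The class $\{C_n : n\ge 3\}$ has bounded incidence clique-width, but no $C_n$ with $n\ge 3$ has a disjoint branches decomposition. 4. Consequently the class of CNF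 formulas with disjoint branches decompositions is incomparable with bounded incidence clique-width: for all sufficiently large $k$, neither that class nor the class of CNF formulas of incidence clique-width at most $k$ contains the other. -/

import Mathlib

/-! ### Clique-width -/

/-- Clique-width expressions over the label set `Fin k`: a single labelled vertex, disjoint union,
renaming every label `i` to `j`, and joining all `i`-labelled vertices to all `j`-labelled vertices
(for `i ≠ j`). -/
inductive CliqueExpr (k : ℕ) : Type
  | vertex (i : Fin k) : CliqueExpr k
  | union (a b : CliqueExpr k) : CliqueExpr k
  | relabel (i j : Fin k) (a : CliqueExpr k) : CliqueExpr k
  | join (i j : Fin k) (hij : i ≠ j) (a : CliqueExpr k) : CliqueExpr k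

namespace CliqueExpr

variable {k : ℕ}

/-- The vertex set of the labelled graph generated by an expression. -/
def Vert : CliqueExpr k → Type
  | vertex _ => Unit
  | union a b => a.Vert ⊕ b.Vert
  | relabel _ _ a => a.Vert
  | join _ _ _ a => a.Vert

/-- The labelling of the graph generated by an expression. -/
def label : (a : CliqueExpr k) → a.Vert → Fin k
  | vertex i => fun _ => i
  | union a b => Sum.elim a.label b.label
  | relabel i j a => fun v => if a.label v = i then j else a.label v
  | join _ _ _ a => a.label

/-- The graph generated by an expression. -/
def graph : (a : CliqueExpr k) → SimpleGraph a.Vert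
  | vertex _ => (⊥ : SimpleGraph Unit)
  | union a b => SimpleGraph.sum a.graph b.graph
  | relabel _ _ a => a.graph
  | join i j _ a => a.graph ⊔ SimpleGraph.fromRel (fun u v => a.label u = i ∧ a.label v = j)

end CliqueExpr

/-- `G` has clique-width at most `k`. Expressions generate only graphs with at least one vertex;
the graph without vertices has clique-width `0`. -/
def CliqueWidthLE {V : Type*} (G : SimpleGraph V) (k : ℕ) : Prop :=
  IsEmpty V ∨ ∃ a : CliqueExpr k, Nonempty (a.graph ≃g G)

/-! ### CNF-formulas -/

/-- A CNF-formula over variables from `α`: a finite set of clauses, where a clause is a finite set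
of literals; `(x, true)` is the literal `x` and `(x, false)` is its negation. -/
abbrev CNFFormula (α : Type*) := Finset (Finset (α × Bool))

namespace CNFFormula

variable {α : Type*}

/-- The set of variables appearing in a clause. -/
def clauseVars (C : Finset (α × Bool)) : Set α := {x | ∃ b, (x, b) ∈ C}

/-- The set of variables of a formula. -/
def vars (F : CNFFormula α) : Set α := {x | ∃ C ∈ F, x ∈ clauseVars C}

/-- The hypergraph of a formula: its vertices are the variables, its edges are the variable sets
of the clauses. -/
def hypergraph (F : CNFFormula α) : Hypergraph α where
  vertexSet := vars F
  edgeSet := {e | ∃ C ∈ F, e = clauseVars C}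
  subset_vertexSet_of_mem_edgeSet' := by
    rintro e ⟨C, hC, rfl⟩ x hx
    exact ⟨C, hC, hx⟩

/-- The incidence graph of a formula: the bipartite graph on its variables and clauses in which a
variable is adjacent to the clauses in which it appears. -/
def incidenceGraph (F : CNFFormula α) : SimpleGraph (↥(vars F) ⊕ {C // C ∈ F}) :=
  SimpleGraph.fromRel fun u v => ∃ x C, u = Sum.inl x ∧ v = Sum.inr C ∧ x.1 ∈ clauseVars C.1

/-- The formula has incidence clique-width at most `k`. -/
def IncidenceCliqueWidthLE (F : CNFFormula α) (k : ℕ) : Prop :=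
  CliqueWidthLE (incidenceGraph F) k

/-- A class of formulas has bounded incidence clique-width. -/
def BoundedIncidenceCliqueWidth (𝒞 : Set (CNFFormula α)) : Prop :=
  ∃ k, ∀ F ∈ 𝒞, IncidenceCliqueWidthLE F k

/-- The formula with the clauses `x_i ∨ x_{i+1}` for `i < n`, indices modulo `n`; for `n ≥ 3` its
hypergraph is the cycle of length `n`. -/
def cycle (n : ℕ) : CNFFormula ℕ :=
  (Finset.range n).image fun i => {(i, true), ((i + 1) % n, true)}

end CNFFormula

/-! ### Join trees, join paths and disjoint branches decompositions -/

namespace Hypergraph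

variable {α : Type*}

/-- `T` is a join tree of `H`. The nodes of the tree are identified with the edges of `H`. -/
def IsJoinTree (H : Hypergraph α) (T : SimpleGraph ↥H.edgeSet) : Prop :=
  T.IsTree ∧ ∀ v ∈ H.vertexSet, (T.induce {t | v ∈ t.1}).Preconnected

/-- `H` has a join path, that is, a join tree which is a path. -/
def HasJoinPath (H : Hypergraph α) : Prop :=
  ∃ T : SimpleGraph ↥H.edgeSet, H.IsJoinTree T ∧ ∃ n, Nonempty (T ≃g SimpleGraph.pathGraph n)

/-- In the tree `T` rooted at `r`, the node `s` is an ancestor of `t` (or `t` itself): it lies on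
the path from the root to `t`. -/
def IsAncestor {N : Type*} (T : SimpleGraph N) (r s t : N) : Prop :=
  ∃ p : T.Walk r t, p.IsPath ∧ s ∈ p.support

/-- The join tree `T`, rooted at `r`, is a disjoint branches decomposition of `H`: any two nodes
on different branches, that is, neither of which is an ancestor of the other, are disjoint. -/
def IsDisjointBranches (H : Hypergraph α) (T : SimpleGraph ↥H.edgeSet) (r : ↥H.edgeSet) : Prop :=
  H.IsJoinTree T ∧
    ∀ s t, ¬ IsAncestor T r s t → ¬ IsAncestor T r t s → Disjoint s.1 t.1

/-- `H` has a disjoint branches decomposition (for some choice of the root). -/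
def HasDisjointBranches (H : Hypergraph α) : Prop :=
  ∃ T r, H.IsDisjointBranches T r

end Hypergraph

namespace CNFFormula

/-- The class of formulas with join paths. -/
def joinPathClass : Set (CNFFormula ℕ) := {F | (hypergraph F).HasJoinPath}

/-- The class of formulas with disjoint branches decompositions. -/
def disjointBranchesClass : Set (CNFFormula ℕ) := {F | (hypergraph F).HasDisjointBranches}

/-- The class of formulas of incidence clique-width at most `k`. -/
def cliqueWidthClass (k : ℕ) : Set (CNFFormula ℕ) := {F | IncidenceCliqueWidthLE F k}

/-- The class of cycle formulas. -/
def cycleClass : Set (CNFFormula ℕ) := {F | ∃ n, 3 ≤ n ∧ F = cycle n}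

end CNFFormula

/-! Lower bound: take a variable for each interval of `{0, ..., m - 1}` and a clause for each point,
containing the intervals through it. The points in their natural order form a join path. Given a
clique-width expression with `k` labels, descending into the heavier side of unions finds a
subexpression whose vertex set `A` contains a balanced part of the points; vertices of `A` with
equal label there have the same neighbours outside `A`. Some threshold has many points of `A` on one
side and many points outside `A` on the other, so the intervals spanned by such pairs form a grid,
with rows indexed by the end in `A` and columns by the end outside. A row inside `A` needs more than
`k` labels. Otherwise each row has an interval outside `A`, and these have more than `2 ^ k`
distinct neighbourhoods in `A`, although each neighbourhood is a union of label classes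
(`SimpleGraph.grid_card_le`).

A join path rooted at an end has a single branch, so disjointness is vacuous.

The incidence graph of `C_n` is a cycle of length `2n`, built with four labels by growing a path and
joining its ends. Consecutive hyperedges of `C_n` share a vertex lying in no other hyperedge, so
they are adjacent in every join tree, which then contains a cycle. -/

/-! ### Paths, and join paths as disjoint branches decompositions -/

namespace SimpleGraph

/-- Each step changes the position by one, so a walk cannot jump over `i`. -/
theorem mem_support_of_walk_pathGraph {n : ℕ} {u v : Fin n} (p : (pathGraph n).Walk u v)
    {i : Fin n} (hu : u ≤ i) (hv : i ≤ v) : i ∈ p.support := by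
  induction p with
  | nil => simp [le_antisymm hv hu]
  | @cons u w v h p ih =>
    rw [Walk.support_cons, List.mem_cons]
    rcases hu.eq_or_lt with rfl | hlt
    · exact Or.inl rfl
    · refine Or.inr (ih ?_ hv)
      rw [pathGraph_adj] at h
      simp only [Fin.le_def, Fin.lt_def] at *
      omega

theorem pathGraph_isTree (n : ℕ) : (pathGraph (n + 1)).IsTree := by
  refine ⟨pathGraph_connected n, isAcyclic_iff_forall_isBridge.2 ?_⟩
  intro e he
  induction e using Sym2.ind with
  | _ u v =>
    wlog huv : u < v generalizing u v
    · rw [Sym2.eq_swap] at he ⊢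
      have hne : u ≠ v := by
        rintro rfl
        simp at he
      exact this v u he (lt_of_le_of_ne (not_lt.1 huv) hne.symm)
    rw [mem_edgeSet, pathGraph_adj] at he
    rw [isBridge_iff]
    rintro ⟨p⟩
    -- Here `v = u + 1`, and the deleted edge is the only one leaving the initial segment up to `u`.
    have key : ∀ {a b : Fin (n + 1)} (q : (pathGraph (n + 1) \ fromEdgeSet {s(u, v)}).Walk a b),
        a ≤ u → b ≤ u := by
      intro a b q
      induction q with
      | nil => exact id
      | @cons a c b h q ih =>
        intro ha
        refine ih ?_
        simp only [sdiff_adj, pathGraph_adj, fromEdgeSet_adj, Set.mem_singleton_iff, Sym2.eq_iff,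
          Fin.ext_iff, not_and_or, not_or] at h
        simp only [Fin.le_def, Fin.lt_def] at *
        omega
    exact absurd (key p le_rfl) (not_le.2 huv)

theorem pathGraph_induce_preconnected {n : ℕ} (S : Set (Fin n)) (hS : S.OrdConnected) :
    ((pathGraph n).induce S).Preconnected := by
  have key : ∀ (d : ℕ) (u v : S), (v : Fin n).val = (u : Fin n).val + d →
      ((pathGraph n).induce S).Reachable u v := by
    intro d
    induction d with
    | zero =>
      intro u v h
      have : u = v := Subtype.ext (Fin.ext (by omega))
      exact this ▸ Reachable.refl _
    | succ d ih =>
      intro u v h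
      have hlt : (u : Fin n).val + d < n := by
        have := (v : Fin n).isLt
        omega
      let w : S := ⟨⟨(u : Fin n).val + d, hlt⟩, hS.out u.2 v.2 ⟨by
        simp [Fin.le_def], by simp [Fin.le_def, h]⟩⟩
      refine (ih u w rfl).trans (Adj.reachable ?_)
      rw [induce_adj, pathGraph_adj]
      left
      simp only [w, h]
      omega
  intro u v
  rcases le_total (u : Fin n).val (v : Fin n).val with h | h
  · exact key _ u v (Nat.add_sub_cancel' h).symm
  · exact (key _ v u (Nat.add_sub_cancel' h).symm).symm

end SimpleGraph

theorem Hypergraph.HasJoinPath.hasDisjointBranches {α : Type*} {H : Hypergraph α}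
    (h : H.HasJoinPath) : H.HasDisjointBranches := by
  obtain ⟨T, hT, n, ⟨f⟩⟩ := h
  obtain ⟨t₀⟩ := hT.1.connected.nonempty
  have hn : 0 < n := (Nat.zero_le _).trans_lt (f t₀).isLt
  refine ⟨T, f.symm ⟨0, hn⟩, hT, fun s t hst hts => ?_⟩
  have key : ∀ s t, f s ≤ f t → Hypergraph.IsAncestor T (f.symm ⟨0, hn⟩) s t := by
    intro s t hle
    obtain ⟨p, hp⟩ := (hT.1.connected (f.symm ⟨0, hn⟩) t).exists_isPath
    refine ⟨p, hp, ?_⟩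
    have := SimpleGraph.mem_support_of_walk_pathGraph (p.map f.toHom) (i := f s)
      (by simp [Fin.le_def]) hle
    rw [SimpleGraph.Walk.support_map, List.mem_map] at this
    obtain ⟨x, hx, hxs⟩ := this
    rwa [f.injective hxs] at hx
  rcases le_total (f s) (f t) with hle | hle
  · exact absurd (key _ _ hle) hst
  · exact absurd (key _ _ hle) hts

/-! ### Balanced cuts from clique-width expressions -/

namespace Set

variable {α β : Type*}

theorem ncard_inter_image_inl (W : Set (α ⊕ β)) (A : Set α) :
    (W ∩ Sum.inl '' A).ncard = (Sum.inl ⁻¹' W ∩ A).ncard := by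
  rw [← ncard_image_of_injective _ (Sum.inl_injective (α := α) (β := β))]
  congr 1
  ext (x | x) <;> simp

theorem ncard_inter_image_inr (W : Set (α ⊕ β)) (B : Set β) :
    (W ∩ Sum.inr '' B).ncard = (Sum.inr ⁻¹' W ∩ B).ncard := by
  rw [← ncard_image_of_injective _ (Sum.inr_injective (α := α) (β := β))]
  congr 1
  ext (x | x) <;> simp

theorem ncard_eq_ncard_preimage_inl_add_inr [Finite α] [Finite β] (W : Set (α ⊕ β)) :
    W.ncard = (Sum.inl ⁻¹' W).ncard + (Sum.inr ⁻¹' W).ncard := by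
  rw [← ncard_image_of_injective _ (Sum.inl_injective (α := α) (β := β)),
    ← ncard_image_of_injective _ (Sum.inr_injective (α := α) (β := β)),
    ← ncard_union_eq ?_ (toFinite _) (toFinite _)]
  · congr 1
    ext (x | x) <;> simp
  · rw [disjoint_left]
    rintro _ ⟨x, _, rfl⟩ ⟨y, _, h⟩
    cases h

end Set

namespace CliqueExpr

variable {k : ℕ}

theorem finite_vert : (a : CliqueExpr k) → Finite a.Vert
  | vertex _ => inferInstanceAs (Finite Unit)
  | union a b =>
    have := finite_vert a
    have := finite_vert b
    inferInstanceAs (Finite (a.Vert ⊕ b.Vert))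
  | relabel _ _ a => finite_vert a
  | join _ _ _ a => finite_vert a

instance (a : CliqueExpr k) : Finite a.Vert := finite_vert a

theorem join_adj {i j : Fin k} {hij : i ≠ j} {a : CliqueExpr k} {u v : a.Vert} :
    (join i j hij a).graph.Adj u v ↔ a.graph.Adj u v ∨ u ≠ v ∧
      ((a.label u = i ∧ a.label v = j) ∨ (a.label v = i ∧ a.label u = j)) :=
  Iff.rfl

/-- Vertices of `A` with equal value under `lab` have the same label in `a` and the same
neighbours outside `A`. -/
def IsModularCut (a : CliqueExpr k) (A : Set a.Vert) (lab : a.Vert → Fin k) : Prop :=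
  ∀ u ∈ A, ∀ v ∈ A, lab u = lab v →
    a.label u = a.label v ∧ ∀ w ∉ A, (a.graph.Adj u w ↔ a.graph.Adj v w)

theorem isModularCut_univ (a : CliqueExpr k) : a.IsModularCut Set.univ a.label :=
  fun _ _ _ _ h => ⟨h, fun w hw => absurd (Set.mem_univ w) hw⟩

/-- `lab` remains the labelling of the subexpression where the cut was made. Its values outside `A`
play no role, so any extension serves, and a union adds no edges leaving `A`. -/
theorem IsModularCut.union_left {a b : CliqueExpr k} {A : Set a.Vert} {lab : a.Vert → Fin k}
    (h : a.IsModularCut A lab) :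
    (union a b).IsModularCut (Sum.inl '' A) (Sum.elim lab b.label) := by
  rintro _ ⟨u, hu, rfl⟩ _ ⟨v, hv, rfl⟩ huv
  obtain ⟨h₁, h₂⟩ := h u hu v hv huv
  refine ⟨h₁, ?_⟩
  rintro (w | w) hw
  · exact h₂ w fun hwA => hw ⟨w, hwA, rfl⟩
  · exact Iff.rfl

theorem IsModularCut.union_right {a b : CliqueExpr k} {B : Set b.Vert} {lab : b.Vert → Fin k}
    (h : b.IsModularCut B lab) :
    (union a b).IsModularCut (Sum.inr '' B) (Sum.elim a.label lab) := by
  rintro _ ⟨u, hu, rfl⟩ _ ⟨v, hv, rfl⟩ huv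
  obtain ⟨h₁, h₂⟩ := h u hu v hv huv
  refine ⟨h₁, ?_⟩
  rintro (w | w) hw
  · exact Iff.rfl
  · exact h₂ w fun hwB => hw ⟨w, hwB, rfl⟩

theorem IsModularCut.relabel {a : CliqueExpr k} {A : Set a.Vert} {lab : a.Vert → Fin k}
    (h : a.IsModularCut A lab) (i j : Fin k) : (CliqueExpr.relabel i j a).IsModularCut A lab := by
  intro u hu v hv huv
  obtain ⟨h₁, h₂⟩ := h u hu v hv huv
  exact ⟨by simp only [label]; rw [h₁], h₂⟩

/-- A join treats equally labelled vertices alike; `w ∉ A` guarantees that `w` differs from both. -/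
theorem IsModularCut.join {a : CliqueExpr k} {A : Set a.Vert} {lab : a.Vert → Fin k}
    (h : a.IsModularCut A lab) (i j : Fin k) (hij : i ≠ j) :
    (CliqueExpr.join i j hij a).IsModularCut A lab := by
  intro u hu v hv huv
  obtain ⟨h₁, h₂⟩ := h u hu v hv huv
  refine ⟨h₁, fun w hw => ?_⟩
  have hu' : u ≠ w := fun h => hw (h ▸ hu)
  have hv' : v ≠ w := fun h => hw (h ▸ hv)
  have key : ∀ x y, a.label x = a.label y → (a.graph.Adj x w ↔ a.graph.Adj y w) → y ≠ w →
      (CliqueExpr.join i j hij a).graph.Adj x w → (CliqueExpr.join i j hij a).graph.Adj y w := by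
    intro x y hxy hadj hy h
    refine join_adj.2 ?_
    rw [← hadj, ← hxy]
    exact (join_adj.1 h).imp_right fun h => ⟨hy, h.2⟩
  exact ⟨key u v h₁ (h₂ w hw) hv', key v u h₁.symm (h₂ w hw).symm hu'⟩

/-- Every set of more than `t` vertices is split by some subexpression in a balanced way. -/
theorem exists_balanced_modularCut {t : ℕ} (ht : 1 ≤ t) :
    ∀ (a : CliqueExpr k) (W : Set a.Vert), t < W.ncard →
      ∃ A lab, a.IsModularCut A lab ∧ t < (W ∩ A).ncard ∧ (W ∩ A).ncard ≤ 2 * t := by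
  intro a
  induction a with
  | vertex i =>
    intro W hW
    have : W.ncard ≤ 1 := by
      have : Subsingleton (vertex i).Vert := inferInstanceAs (Subsingleton Unit)
      exact Set.ncard_le_one_of_subsingleton W
    omega
  | union a b iha ihb =>
    intro W hW
    -- A set of size at most `2 * t` is already balanced for the whole expression; a larger one has
    -- more than `t` elements on one side of the union.
    by_cases hW2 : W.ncard ≤ 2 * t
    · exact ⟨_, _, isModularCut_univ _, by simpa using hW, by simpa using hW2⟩
    have hcard := Set.ncard_eq_ncard_preimage_inl_add_inr (α := a.Vert) (β := b.Vert) W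
    by_cases ha : t < (Sum.inl ⁻¹' W : Set a.Vert).ncard
    · obtain ⟨A, lab, hA, h₁, h₂⟩ := iha _ ha
      have e := Set.ncard_inter_image_inl (α := a.Vert) (β := b.Vert) W A
      exact ⟨_, _, hA.union_left, h₁.trans_eq e.symm, e.trans_le h₂⟩
    · obtain ⟨A, lab, hA, h₁, h₂⟩ := ihb (Sum.inr ⁻¹' W) (by
        by_contra hb
        refine hW2 (hcard.trans_le ?_)
        rw [two_mul]
        exact add_le_add (not_lt.1 ha) (not_lt.1 hb))
      have e := Set.ncard_inter_image_inr (α := a.Vert) (β := b.Vert) W A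
      exact ⟨_, _, hA.union_right, h₁.trans_eq e.symm, e.trans_le h₂⟩
  | relabel i j a ih =>
    intro W hW
    obtain ⟨A, lab, hA, h⟩ := ih W hW
    exact ⟨A, lab, hA.relabel i j, h⟩
  | join i j hij a ih =>
    intro W hW
    obtain ⟨A, lab, hA, h⟩ := ih W hW
    exact ⟨A, lab, hA.join i j hij, h⟩

end CliqueExpr

theorem CliqueWidthLE.exists_balanced_cut {V : Type*} {G : SimpleGraph V} {k : ℕ}
    (h : CliqueWidthLE G k) {t : ℕ} (ht : 1 ≤ t) (W : Set V) (hW : t < W.ncard) :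
    ∃ (A : Set V) (lab : V → Fin k),
      (∀ u ∈ A, ∀ v ∈ A, lab u = lab v → ∀ w ∉ A, (G.Adj u w ↔ G.Adj v w)) ∧
      t < (W ∩ A).ncard ∧ (W ∩ A).ncard ≤ 2 * t := by
  rcases h with hV | ⟨a, ⟨e⟩⟩
  · rw [Set.eq_empty_of_isEmpty W] at hW
    simp at hW
  have hcard : ∀ X : Set V, (e ⁻¹' X).ncard = X.ncard := fun X =>
    Set.ncard_preimage_of_injective_subset_range e.injective (by simp [e.surjective.range_eq])
  obtain ⟨A, lab, hA, h₁, h₂⟩ := a.exists_balanced_modularCut ht (e ⁻¹' W) (by rwa [hcard])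
  have hi : e ⁻¹' W ∩ A = e ⁻¹' (W ∩ e.symm ⁻¹' A) := by
    ext x
    simp
  rw [hi, hcard] at h₁ h₂
  refine ⟨e.symm ⁻¹' A, lab ∘ e.symm, fun u hu v hv huv w hw => ?_, h₁, h₂⟩
  have := (hA _ hu _ hv huv).2 _ hw
  rwa [e.symm.map_adj_iff, e.symm.map_adj_iff] at this

/-! ### Interval systems force large clique-width -/

/-- The two sides of a cut with few labels cannot both distinguish many vertices of a grid. -/
theorem SimpleGraph.grid_card_le {V ρ κ : Type*} [Fintype ρ] [Fintype κ] {G : SimpleGraph V}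
    {k : ℕ} {A : Set V} {lab : V → Fin k}
    (hA : ∀ u ∈ A, ∀ v ∈ A, lab u = lab v → ∀ w ∉ A, (G.Adj u w ↔ G.Adj v w))
    (f : ρ → κ → V)
    (hcol : ∀ r q q', q ≠ q' → ∃ x ∉ A, ¬(G.Adj (f r q) x ↔ G.Adj (f r q') x))
    (hrow : ∀ r r' q q', r ≠ r' → ∃ x ∈ A, ¬(G.Adj (f r q) x ↔ G.Adj (f r' q') x)) :
    Fintype.card κ ≤ k ∨ Fintype.card ρ ≤ 2 ^ k := by
  refine or_iff_not_imp_left.2 fun hk => ?_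
  -- In a row inside `A`, `hcol` makes all labels distinct, leaving at most `k` columns.
  have hout : ∀ r, ∃ q, f r q ∉ A := by
    intro r
    by_contra! hin
    refine hk ?_
    rw [← Fintype.card_fin k]
    refine Fintype.card_le_of_injective (fun q => lab (f r q)) fun q q' hq => ?_
    by_contra hne
    obtain ⟨x, hx, hne⟩ := hcol r q q' hne
    exact hne (hA _ (hin q) _ (hin q') hq x hx)
  choose g hg using hout
  have hcard : 2 ^ k = Fintype.card (Set (Fin k)) := by simp
  rw [hcard]
  -- The neighbourhood in `A` of a vertex outside `A` is determined by the set of labels occurring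
  -- in it.
  refine Fintype.card_le_of_injective
    (fun r => {l | ∃ a ∈ A, lab a = l ∧ G.Adj a (f r (g r))}) fun r r' hr => ?_
  by_contra hne
  obtain ⟨x, hx, hne⟩ := hrow r r' (g r) (g r') hne
  have key : ∀ r r', {l | ∃ a ∈ A, lab a = l ∧ G.Adj a (f r (g r))} ⊆
      {l | ∃ a ∈ A, lab a = l ∧ G.Adj a (f r' (g r'))} →
      G.Adj (f r (g r)) x → G.Adj (f r' (g r')) x := by
    intro r r' hsub hadj
    obtain ⟨a, ha, hl, hadj'⟩ := hsub ⟨x, hx, rfl, hadj.symm⟩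
    exact ((hA a ha x hx hl _ (hg r')).1 hadj').symm
  exact hne ⟨key r r' hr.subset, key r' r hr.superset⟩

/-- For two large sets of numbers, some threshold has many points of one of them below it and
many points of the other one above it. -/
theorem Finset.exists_threshold {m N : ℕ} (S T : Finset (Fin m))
    (hS : 2 * N ≤ S.card) (hT : 2 * N ≤ T.card) :
    ∃ c : ℕ, (N ≤ (S.filter fun x => x.1 < c).card ∧ N ≤ (T.filter fun x => ¬ x.1 < c).card) ∨
      (N ≤ (T.filter fun x => x.1 < c).card ∧ N ≤ (S.filter fun x => ¬ x.1 < c).card) := by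
  have hstep : ∀ (S : Finset (Fin m)) c, (S.filter fun x => x.1 < c + 1).card ≤
      (S.filter fun x => x.1 < c).card + 1 := by
    intro S c
    have h1 : (S.filter fun x => x.1 = c).card ≤ 1 := by
      refine Finset.card_le_one.2 fun a ha b hb => Fin.ext ?_
      rw [(Finset.mem_filter.1 ha).2, (Finset.mem_filter.1 hb).2]
    refine le_trans (Finset.card_le_card fun x hx => ?_)
      ((Finset.card_union_le _ (S.filter fun x => x.1 = c)).trans (Nat.add_le_add_left h1 _))
    simp only [Finset.mem_union, Finset.mem_filter] at hx ⊢
    exact (Nat.lt_succ_iff_lt_or_eq.1 hx.2).imp (⟨hx.1, ·⟩) (⟨hx.1, ·⟩)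
  have hex : ∃ c, N ≤ (S.filter fun x => x.1 < c).card ∨
      N ≤ (T.filter fun x => x.1 < c).card := by
    refine ⟨m, Or.inl ?_⟩
    rw [Finset.filter_true_of_mem fun x _ => x.2]
    omega
  -- At the least threshold where one count reaches `N`, both are still at most `N`, since counts
  -- grow by at most one per step. Hence both sets keep at least `N` points above.
  obtain ⟨c, hc, hmin⟩ : ∃ c, (N ≤ (S.filter fun x => x.1 < c).card ∨
      N ≤ (T.filter fun x => x.1 < c).card) ∧
      ((S.filter fun x => x.1 < c).card ≤ N ∧ (T.filter fun x => x.1 < c).card ≤ N) := by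
    classical
    refine ⟨Nat.find hex, Nat.find_spec hex, ?_⟩
    rcases h : Nat.find hex with _ | c
    · simp
    · have := Nat.find_min hex (m := c) (by omega)
      have h1 := hstep S c
      have h2 := hstep T c
      omega
  have h1 := S.card_filter_add_card_filter_not fun x => x.1 < c
  have h2 := T.card_filter_add_card_filter_not fun x => x.1 < c
  refine ⟨c, ?_⟩
  omega

/-- A graph in which every interval of a long path of points has a vertex adjacent to exactly
the points of the interval has large clique-width. -/
theorem not_cliqueWidthLE_of_intervals {V : Type*} {G : SimpleGraph V} {k m : ℕ}
    (hm : 8 * (2 ^ k + 1) ≤ m) (c : Fin m → V) (hc : Function.Injective c)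
    (v : Fin m → Fin m → V)
    (hv : ∀ i j x, i ≤ j → (G.Adj (v i j) (c x) ↔ i ≤ x ∧ x ≤ j)) : ¬ CliqueWidthLE G k := by
  classical
  intro h
  have hk : k < 2 ^ k := Nat.lt_two_pow_self
  -- With `N = 2 ^ k + 1` and `t = 2 * N`, between `2 * N` and `4 * N` points lie in `A` and, as `m
  -- ≥ 8 * N`, at least `4 * N` outside: enough for the threshold lemma.
  obtain ⟨A, lab, hA, h₁, h₂⟩ := h.exists_balanced_cut (t := 2 * (2 ^ k + 1)) (by omega)
    (Set.range c) (by
      rw [← Set.image_univ, Set.ncard_image_of_injective _ hc, Set.ncard_univ, Nat.card_fin]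
      omega)
  set S : Finset (Fin m) := Finset.univ.filter fun x => c x ∈ A with hS
  set T : Finset (Fin m) := Finset.univ.filter fun x => ¬ c x ∈ A with hT
  have hSc : (Set.range c ∩ A).ncard = S.card := by
    rw [← Set.ncard_coe_finset, ← Set.ncard_image_of_injective _ hc]
    congr 1
    ext x
    simp only [hS, Set.mem_inter_iff, Set.mem_range, Set.mem_image, Finset.coe_filter,
      Finset.mem_univ, true_and, Set.mem_ofPred_eq]
    constructor
    · rintro ⟨⟨y, rfl⟩, hy⟩
      exact ⟨y, hy, rfl⟩
    · rintro ⟨y, hy, rfl⟩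
      exact ⟨⟨y, rfl⟩, hy⟩
  have hST : S.card + T.card = m := by
    rw [hS, hT, Finset.card_filter_add_card_filter_not, Finset.card_univ, Fintype.card_fin]
  rw [hSc] at h₁ h₂
  -- The smaller of two left ends separates the intervals; for right ends it is the larger one.
  have hleft : ∀ (X : Set V) i i' j j', i ≤ j → i' ≤ j → i ≤ j' → i' ≤ j' → i ≠ i' → c i ∈ X →
      c i' ∈ X → ∃ y ∈ X, ¬ (G.Adj (v i j) y ↔ G.Adj (v i' j') y) := by
    intro X i i' j j' h₁ h₂ h₃ h₄ hne hi hi'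
    rcases lt_or_gt_of_ne hne with hlt | hlt
    · exact ⟨c i, hi, by rw [hv _ _ _ h₁, hv _ _ _ h₄]; omega⟩
    · exact ⟨c i', hi', by rw [hv _ _ _ h₁, hv _ _ _ h₄]; omega⟩
  have hright : ∀ (X : Set V) i i' j j', i ≤ j → i' ≤ j → i ≤ j' → i' ≤ j' → j ≠ j' → c j ∈ X →
      c j' ∈ X → ∃ y ∈ X, ¬ (G.Adj (v i j) y ↔ G.Adj (v i' j') y) := by
    intro X i i' j j' h₁ h₂ h₃ h₄ hne hj hj'
    rcases lt_or_gt_of_ne hne with hlt | hlt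
    · exact ⟨c j', hj', by rw [hv _ _ _ h₁, hv _ _ _ h₄]; omega⟩
    · exact ⟨c j, hj, by rw [hv _ _ _ h₁, hv _ _ _ h₄]; omega⟩
  have hmS : ∀ x, x ∈ S → c x ∈ A := fun x hx => (Finset.mem_filter.1 hx).2
  have hmT : ∀ x, x ∈ T → c x ∈ Aᶜ := fun x hx => (Finset.mem_filter.1 hx).2
  have hle : ∀ (X Y : Finset (Fin m)) d, ∀ x ∈ X.filter fun x => x.1 < d,
      ∀ y ∈ Y.filter fun x => ¬ x.1 < d, x ≤ y := fun X Y d x hx y hy =>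
    ((Finset.mem_filter.1 hx).2.trans_le (not_lt.1 (Finset.mem_filter.1 hy).2)).le
  -- In both cases the rows are the ends in `A`: left ends in the first case, right ends in the
  -- second.
  obtain ⟨d, ⟨hR, hQ⟩ | ⟨hR, hQ⟩⟩ := S.exists_threshold T (N := 2 ^ k + 1) (by omega) (by omega)
  · have := SimpleGraph.grid_card_le hA
      (fun (r : {x // x ∈ S.filter fun x => x.1 < d})
        (q : {x // x ∈ T.filter fun x => ¬ x.1 < d}) => v r q) ?_ ?_
    · simp only [Fintype.card_coe] at this
      omega
    · intro r q q' hne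
      exact hright Aᶜ _ _ _ _ (hle _ _ _ _ r.2 _ q.2) (hle _ _ _ _ r.2 _ q.2)
        (hle _ _ _ _ r.2 _ q'.2) (hle _ _ _ _ r.2 _ q'.2) (Subtype.coe_ne_coe.2 hne)
        (hmT _ (Finset.mem_filter.1 q.2).1) (hmT _ (Finset.mem_filter.1 q'.2).1)
    · intro r r' q q' hne
      exact hleft A _ _ _ _ (hle _ _ _ _ r.2 _ q.2) (hle _ _ _ _ r'.2 _ q.2)
        (hle _ _ _ _ r.2 _ q'.2) (hle _ _ _ _ r'.2 _ q'.2) (Subtype.coe_ne_coe.2 hne)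
        (hmS _ (Finset.mem_filter.1 r.2).1) (hmS _ (Finset.mem_filter.1 r'.2).1)
  · have := SimpleGraph.grid_card_le hA
      (fun (q : {x // x ∈ S.filter fun x => ¬ x.1 < d})
        (r : {x // x ∈ T.filter fun x => x.1 < d}) => v r q) ?_ ?_
    · simp only [Fintype.card_coe] at this
      omega
    · intro q r r' hne
      exact hleft Aᶜ _ _ _ _ (hle _ _ _ _ r.2 _ q.2) (hle _ _ _ _ r'.2 _ q.2)
        (hle _ _ _ _ r.2 _ q.2) (hle _ _ _ _ r'.2 _ q.2) (Subtype.coe_ne_coe.2 hne)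
        (hmT _ (Finset.mem_filter.1 r.2).1) (hmT _ (Finset.mem_filter.1 r'.2).1)
    · intro q q' r r' hne
      exact hright A _ _ _ _ (hle _ _ _ _ r.2 _ q.2) (hle _ _ _ _ r'.2 _ q.2)
        (hle _ _ _ _ r.2 _ q'.2) (hle _ _ _ _ r'.2 _ q'.2) (Subtype.coe_ne_coe.2 hne)
        (hmS _ (Finset.mem_filter.1 q.2).1) (hmS _ (Finset.mem_filter.1 q'.2).1)

/-! ### The interval formulas -/

theorem Hypergraph.hasJoinPath_of_equiv {α : Type*} {H : Hypergraph α} {n : ℕ}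
    (f : Fin (n + 1) ≃ ↥H.edgeSet) (hf : ∀ v, {i | v ∈ (f i).1}.OrdConnected) :
    H.HasJoinPath := by
  let e : SimpleGraph.pathGraph (n + 1) ≃g (SimpleGraph.pathGraph (n + 1)).map f.toEmbedding :=
    SimpleGraph.Iso.map f _
  refine ⟨_, ⟨e.isTree_iff.1 (SimpleGraph.pathGraph_isTree n), fun v _ => ?_⟩, n + 1, ⟨e.symm⟩⟩
  let g : (SimpleGraph.pathGraph (n + 1)).induce {i | v ∈ (f i).1} →g
      ((SimpleGraph.pathGraph (n + 1)).map f.toEmbedding).induce {t | v ∈ t.1} :=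
    ⟨fun i => ⟨f i.1, i.2⟩, fun {i j} h => e.map_adj_iff.2 h⟩
  refine (SimpleGraph.pathGraph_induce_preconnected _ (hf v)).map g ?_
  rintro ⟨t, ht⟩
  exact ⟨⟨f.symm t, by simpa using ht⟩, Subtype.ext (f.apply_symm_apply t)⟩

namespace CNFFormula

theorem incidenceGraph_adj_inl_inr {α : Type*} {F : CNFFormula α} {x : ↥(vars F)}
    {C : {C // C ∈ F}} :
    (incidenceGraph F).Adj (Sum.inl x) (Sum.inr C) ↔ x.1 ∈ clauseVars C.1 := by
  rw [incidenceGraph, SimpleGraph.fromRel_adj]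
  constructor
  · rintro ⟨-, ⟨y, D, hy, hD, h⟩ | ⟨y, D, hy, hD, h⟩⟩
    · cases hy
      cases hD
      exact h
    · cases hy
  · exact fun h => ⟨Sum.inl_ne_inr, Or.inl ⟨x, C, rfl, rfl, h⟩⟩

/-- The clause whose variables are the intervals `[i, j]` with `i ≤ p ≤ j < m`. -/
def intervalClause (m p : ℕ) : Finset (ℕ × Bool) :=
  (Finset.range (p + 1) ×ˢ Finset.Ico p m).image fun ij => (Nat.pair ij.1 ij.2, true)

theorem mem_clauseVars_intervalClause {m p x : ℕ} :
    x ∈ clauseVars (intervalClause m p) ↔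
      x.unpair.1 ≤ p ∧ p ≤ x.unpair.2 ∧ x.unpair.2 < m := by
  simp only [clauseVars, intervalClause, Set.mem_ofPred_eq, Finset.mem_image, Finset.mem_product,
    Finset.mem_range, Finset.mem_Ico, Prod.mk.injEq, Prod.exists]
  constructor
  · rintro ⟨b, i, j, ⟨h₁, h₂⟩, rfl, -⟩
    simp only [Nat.unpair_pair]
    omega
  · rintro ⟨h₁, h₂, h₃⟩
    exact ⟨true, x.unpair.1, x.unpair.2, ⟨by omega, h₂, h₃⟩, Nat.pair_unpair x, rfl⟩

/-- The formula with a variable for each interval in `{0, ..., m - 1}` and a clause for each of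
these points, containing the intervals through the point. -/
def intervals (m : ℕ) : CNFFormula ℕ := (Finset.range m).image (intervalClause m)

theorem intervalClause_mem {m : ℕ} (p : Fin m) : intervalClause m p ∈ intervals m :=
  Finset.mem_image_of_mem _ (Finset.mem_range.2 p.2)

/-- The one-point interval at `p` occurs in the clause of `p` only. -/
theorem eq_of_clauseVars_intervalClause_eq {m : ℕ} {p q : Fin m}
    (h : clauseVars (intervalClause m p) = clauseVars (intervalClause m q)) : p = q := by
  have : Nat.pair p p ∈ clauseVars (intervalClause m p) := by
    simp [mem_clauseVars_intervalClause]
  rw [h, mem_clauseVars_intervalClause, Nat.unpair_pair] at this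
  exact Fin.ext (le_antisymm this.1 this.2.1)

theorem intervals_hasJoinPath (n : ℕ) : (hypergraph (intervals (n + 1))).HasJoinPath := by
  let f : Fin (n + 1) → ↥(hypergraph (intervals (n + 1))).edgeSet :=
    fun p => ⟨clauseVars (intervalClause (n + 1) p), _, intervalClause_mem p, rfl⟩
  have hf : Function.Bijective f := by
    refine ⟨fun p q h => eq_of_clauseVars_intervalClause_eq (Subtype.ext_iff.1 h), ?_⟩
    rintro ⟨_, C, hC, rfl⟩
    obtain ⟨p, hp, rfl⟩ := Finset.mem_image.1 hC
    exact ⟨⟨p, Finset.mem_range.1 hp⟩, rfl⟩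
  refine Hypergraph.hasJoinPath_of_equiv (Equiv.ofBijective f hf) fun v => ⟨?_⟩
  intro p hp q hq x hx
  have hp' := mem_clauseVars_intervalClause.1 hp
  have hq' := mem_clauseVars_intervalClause.1 hq
  exact mem_clauseVars_intervalClause.2
    ⟨hp'.1.trans hx.1, le_trans (Fin.le_def.1 hx.2) hq'.2.1, hq'.2.2⟩

theorem not_incidenceCliqueWidthLE_intervals {k m : ℕ} (hm : 8 * (2 ^ k + 1) ≤ m) :
    ¬ IncidenceCliqueWidthLE (intervals m) k := by
  -- `min` and `max` make the interval a variable of the formula for every pair; only pairs with `i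
  -- ≤ j` matter later.
  have hmem : ∀ i j : Fin m, Nat.pair (min i.1 j.1) (max i.1 j.1) ∈ vars (intervals m) :=
    fun i j => ⟨_, intervalClause_mem i, by
      rw [mem_clauseVars_intervalClause, Nat.unpair_pair]
      exact ⟨min_le_left _ _, le_max_left _ _, max_lt i.2 j.2⟩⟩
  refine not_cliqueWidthLE_of_intervals hm (fun p => Sum.inr ⟨_, intervalClause_mem p⟩) ?_
    (fun i j => Sum.inl ⟨_, hmem i j⟩) ?_
  · intro p q h
    exact eq_of_clauseVars_intervalClause_eq
      (congrArg clauseVars (Subtype.ext_iff.1 (Sum.inr_injective h)))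
  · intro i j x hij
    rw [incidenceGraph_adj_inl_inr, mem_clauseVars_intervalClause, Nat.unpair_pair,
      min_eq_left (Fin.le_def.1 hij), max_eq_right (Fin.le_def.1 hij), Fin.le_def, Fin.le_def]
    simp

theorem not_boundedIncidenceCliqueWidth_joinPathClass :
    ¬ BoundedIncidenceCliqueWidth joinPathClass := by
  rintro ⟨k, hk⟩
  exact not_incidenceCliqueWidthLE_intervals (k := k) (m := 8 * (2 ^ k + 1) + 1) (by omega)
    (hk _ (intervals_hasJoinPath _))

theorem joinPathClass_subset_disjointBranchesClass : joinPathClass ⊆ disjointBranchesClass :=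
  fun _ h => Hypergraph.HasJoinPath.hasDisjointBranches h

end CNFFormula

/-! ### Cycles have clique-width at most four -/

/-- Some expression generates the graph `G` with the labelling `lab`. -/
def CliqueExpr.Generates {k : ℕ} {V : Type*} (G : SimpleGraph V) (lab : V → Fin k) : Prop :=
  ∃ (a : CliqueExpr k) (e : a.graph ≃g G), ∀ u, lab (e u) = a.label u

namespace CliqueExpr.Generates

variable {k : ℕ} {V W : Type*} {G : SimpleGraph V} {H : SimpleGraph W}
  {lab : V → Fin k} {lab' : W → Fin k}

theorem of_equiv (h : Generates G lab) (e : V ≃ W)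
    (hadj : ∀ u v, H.Adj (e u) (e v) ↔ G.Adj u v) (hlab : ∀ u, lab' (e u) = lab u) :
    Generates H lab' := by
  obtain ⟨a, f, hf⟩ := h
  exact ⟨a, f.trans ⟨e, fun {u v} => hadj u v⟩, fun u => (hlab _).trans (hf u)⟩

theorem fin_one (i : Fin k) : Generates (⊥ : SimpleGraph (Fin 1)) fun _ => i :=
  ⟨vertex i, ⟨Equiv.ofUnique Unit (Fin 1), fun {_ _} => Iff.rfl⟩, fun _ => rfl⟩

theorem union (hG : Generates G lab) (hH : Generates H lab') :
    Generates (G.sum H) (Sum.elim lab lab') := by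
  obtain ⟨a, e, he⟩ := hG
  obtain ⟨b, f, hf⟩ := hH
  refine ⟨a.union b, ⟨Equiv.sumCongr e.toEquiv f.toEquiv, ?_⟩, ?_⟩
  · rintro (u | u) (v | v)
    · exact e.map_adj_iff
    · exact Iff.rfl
    · exact Iff.rfl
    · exact f.map_adj_iff
  · rintro (u | u)
    · exact he u
    · exact hf u

theorem relabel (h : Generates G lab) (i j : Fin k) :
    Generates G fun v => if lab v = i then j else lab v := by
  obtain ⟨a, e, he⟩ := h
  refine ⟨a.relabel i j, e, fun u => ?_⟩
  change (if lab (e u) = i then j else lab (e u)) = if a.label u = i then j else a.label u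
  rw [he u]

theorem join (h : Generates G lab) {i j : Fin k} (hij : i ≠ j) :
    Generates (G ⊔ SimpleGraph.fromRel fun u v => lab u = i ∧ lab v = j) lab := by
  obtain ⟨a, e, he⟩ := h
  refine ⟨a.join i j hij, ⟨e.toEquiv, fun {u v} => ?_⟩, he⟩
  refine Iff.trans ?_ join_adj.symm
  have key : ∀ u v : a.Vert, (G.Adj (e u) (e v) ∨ e u ≠ e v ∧
      ((lab (e u) = i ∧ lab (e v) = j) ∨ (lab (e v) = i ∧ lab (e u) = j))) ↔
      (a.graph.Adj u v ∨ u ≠ v ∧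
        ((a.label u = i ∧ a.label v = j) ∨ (a.label v = i ∧ a.label u = j))) := by
    intro u v
    rw [he u, he v, e.map_adj_iff, e.injective.ne_iff]
  exact key u v

theorem cliqueWidthLE (h : Generates G lab) : CliqueWidthLE G k := by
  obtain ⟨a, e, -⟩ := h
  exact Or.inr ⟨a, ⟨e⟩⟩

/-- A path, with one label for each of its ends and one label for its inner vertices. -/
theorem pathGraph {l₀ l₁ l₂ l₃ : Fin k} (h₀₁ : l₀ ≠ l₁) (h₀₃ : l₀ ≠ l₃)
    (h₁₂ : l₁ ≠ l₂) (h₁₃ : l₁ ≠ l₃) (h₂₃ : l₂ ≠ l₃) (n : ℕ) :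
    Generates (SimpleGraph.pathGraph (n + 2))
      fun i => if i.1 = 0 then l₀ else if i.1 = n + 1 then l₁ else l₂ := by
  induction n with
  | zero =>
    obtain ⟨e, hl, hr⟩ : ∃ e : Fin 1 ⊕ Fin 1 ≃ Fin (0 + 2), (∀ u, (e (Sum.inl u)).val = 0) ∧
      ∀ u, (e (Sum.inr u)).val = 1 := ⟨finSumFinEquiv, by decide, by decide⟩
    refine (((fin_one l₀).union (fin_one l₁)).join h₀₁).of_equiv e ?_ ?_
    · rintro (u | u) (v | v) <;>
        simp [SimpleGraph.pathGraph_adj, hl, hr, h₀₁, h₀₁.symm]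
    · rintro (u | u) <;> simp [hl, hr]
  | succ n ih =>
    obtain ⟨e, hl, hr⟩ : ∃ e : Fin (n + 2) ⊕ Fin 1 ≃ Fin (n + 1 + 2),
        (∀ u, (e (Sum.inl u)).val = u.val) ∧ ∀ u, (e (Sum.inr u)).val = n + 2 :=
      ⟨finSumFinEquiv, fun u => rfl, fun u => by
        rw [Fin.fin_one_eq_zero u]
        rfl⟩
    set P : Fin (n + 2) → Fin k :=
      fun i => if i.1 = 0 then l₀ else if i.1 = n + 1 then l₁ else l₂ with hP
    have hP₁ : ∀ i, P i = l₁ ↔ i.1 = n + 1 := by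
      intro i
      simp only [hP]
      split_ifs with h₁ h₂
      · simp [h₀₁, h₁]
      · simp [h₂]
      · simp [h₁₂.symm, h₂]
    have hP₃ : ∀ i, P i ≠ l₃ := by
      intro i
      simp only [hP]
      split_ifs <;> assumption
    -- The new vertex enters with the spare label `l₃` and is joined to the old end, labelled `l₁`;
    -- then the old end becomes inner and the new vertex takes over `l₁`.
    refine ((((ih.union (fin_one l₃)).join h₁₃).relabel l₁ l₂).relabel l₃ l₁).of_equiv e ?_ ?_
    · rintro (u | u) (v | v)
      · simp [SimpleGraph.pathGraph_adj, hl, hP₃]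
      · have := u.2
        simp [SimpleGraph.pathGraph_adj, hl, hr, hP₁, hP₃, h₁₃.symm]
        omega
      · have := v.2
        simp [SimpleGraph.pathGraph_adj, hl, hr, hP₁, hP₃, h₁₃.symm]
        omega
      · simp [SimpleGraph.pathGraph_adj, hr, h₁₃.symm]
    · rintro (u | u)
      · have := u.2
        simp only [hl, Sum.elim_inl, hP₁]
        by_cases h₁ : u.1 = n + 1
        · simp [h₁, h₂₃]
        · rw [if_neg h₁, if_neg (hP₃ u), if_neg (show ¬ u.1 = n + 1 + 1 by omega), hP]
          simp only [h₁, if_false]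
      · simp [hr, h₁₃.symm]

end CliqueExpr.Generates

/-- The ends of the path are the only vertices with labels `l 0` and `l 1`, so one join of these
labels adds exactly the closing edge. -/
theorem cliqueWidthLE_of_cycle {k N : ℕ} (hk : 4 ≤ k) (hN : 2 ≤ N) {V : Type*}
    {G : SimpleGraph V} (e : Fin N ≃ V)
    (h : ∀ i j : Fin N, i < j → (G.Adj (e i) (e j) ↔ i.1 + 1 = j.1 ∨ i.1 = 0 ∧ j.1 + 1 = N)) :
    CliqueWidthLE G k := by
  obtain ⟨n, rfl⟩ := Nat.exists_eq_add_of_le' hN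
  let l : Fin 4 → Fin k := Fin.castLE hk
  have hl : ∀ {i j}, i ≠ j → l i ≠ l j := fun h => (Fin.castLE_injective hk).ne h
  have hpath := CliqueExpr.Generates.pathGraph (hl (i := 0) (j := 1) (by decide))
    (hl (i := 0) (j := 3) (by decide))
    (hl (i := 1) (j := 2) (by decide)) (hl (i := 1) (j := 3) (by decide))
    (hl (i := 2) (j := 3) (by decide)) n
  have h01 : l 0 ≠ l 1 := hl (by decide)
  have h20 : l 2 ≠ l 0 := hl (by decide)
  have h21 : l 2 ≠ l 1 := hl (by decide)
  have h0 : ∀ i : ℕ, (if i = 0 then l 0 else if i = n + 1 then l 1 else l 2) = l 0 ↔ i = 0 := by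
    intro i
    split_ifs with h₁ h₂ <;> simp [h₁, h01.symm, h20]
  have h1 : ∀ i : ℕ, (if i = 0 then l 0 else if i = n + 1 then l 1 else l 2) = l 1 ↔
      i = n + 1 := by
    intro i
    split_ifs with h₁ h₂
    · simp [h01, h₁]
    · simp [h₂]
    · simp [h21, h₂]
  refine ((hpath.join h01).of_equiv (lab' := fun v =>
    if (e.symm v).1 = 0 then l 0 else if (e.symm v).1 = n + 1 then l 1 else l 2) e
    (fun i j => ?_) fun i => by simp).cliqueWidthLE
  have key : ∀ i j : Fin (n + 2), i < j → (G.Adj (e i) (e j) ↔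
      (SimpleGraph.pathGraph (n + 2) ⊔ SimpleGraph.fromRel fun i j : Fin (n + 2) =>
        (if i.1 = 0 then l 0 else if i.1 = n + 1 then l 1 else l 2) = l 0 ∧
        (if j.1 = 0 then l 0 else if j.1 = n + 1 then l 1 else l 2) = l 1).Adj i j) := by
    intro i j hij
    rw [h i j hij]
    simp only [h0, h1, SimpleGraph.sup_adj, SimpleGraph.fromRel_adj, SimpleGraph.pathGraph_adj,
      ne_eq, hij.ne, not_false_eq_true, true_and]
    rw [Fin.lt_def] at hij
    omega
  rcases lt_trichotomy i j with hij | rfl | hij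
  · exact key i j hij
  · simp only [SimpleGraph.irrefl]
  · rw [SimpleGraph.adj_comm, SimpleGraph.adj_comm _ i j]
    exact key j i hij

/-! ### The cycle formulas -/

namespace CNFFormula

/-- The clause `x_i ∨ x_{i+1}` of the cycle formula. -/
def cycleClause {n : ℕ} (i : Fin n) : Finset (ℕ × Bool) :=
  {(i.1, true), ((i.1 + 1) % n, true)}

theorem mem_clauseVars_cycleClause {n : ℕ} {i : Fin n} {x : ℕ} :
    x ∈ clauseVars (cycleClause i) ↔ x = i.1 ∨ x = (i.1 + 1) % n := by
  simp [clauseVars, cycleClause]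

theorem mem_cycle {n : ℕ} {C : Finset (ℕ × Bool)} :
    C ∈ cycle n ↔ ∃ i : Fin n, cycleClause i = C := by
  simp only [cycle, Finset.mem_image, Finset.mem_range]
  exact ⟨fun ⟨i, hi, h⟩ => ⟨⟨i, hi⟩, h⟩, fun ⟨i, h⟩ => ⟨i.1, i.2, h⟩⟩

theorem mem_vars_cycle {n x : ℕ} : x ∈ vars (cycle n) ↔ x < n := by
  constructor
  · rintro ⟨C, hC, hx⟩
    obtain ⟨i, rfl⟩ := mem_cycle.1 hC
    rcases mem_clauseVars_cycleClause.1 hx with rfl | rfl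
    · exact i.2
    · exact Nat.mod_lt _ (Nat.zero_lt_of_lt i.2)
  · exact fun hx => ⟨_, mem_cycle.2 ⟨⟨x, hx⟩, rfl⟩, mem_clauseVars_cycleClause.2 (Or.inl rfl)⟩

theorem succ_mod_eq {n i : ℕ} (h : i < n) : (i + 1) % n = if i + 1 = n then 0 else i + 1 := by
  split_ifs with hi
  · rw [hi, Nat.mod_self]
  · exact Nat.mod_eq_of_lt (by omega)

/-- For `n = 2` this fails: both clauses have the same two variables. -/
theorem eq_of_clauseVars_cycleClause_eq {n : ℕ} (hn : 3 ≤ n) {i j : Fin n}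
    (h : clauseVars (cycleClause i) = clauseVars (cycleClause j)) : i = j := by
  have h₁ := mem_clauseVars_cycleClause.1 (h ▸ mem_clauseVars_cycleClause.2 (Or.inl rfl) :
    i.1 ∈ clauseVars (cycleClause j))
  have h₂ := mem_clauseVars_cycleClause.1 (h ▸ mem_clauseVars_cycleClause.2 (Or.inr rfl) :
    (i.1 + 1) % n ∈ clauseVars (cycleClause j))
  rw [succ_mod_eq i.2, succ_mod_eq j.2] at h₂
  rw [succ_mod_eq j.2] at h₁
  refine Fin.ext ?_
  split_ifs at h₁ h₂ <;> grind

theorem incidenceCliqueWidthLE_cycle {k n : ℕ} (hk : 4 ≤ k) (hn : 3 ≤ n) :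
    IncidenceCliqueWidthLE (cycle n) k := by
  have hdiv : ∀ i : Fin (2 * n), i.1 / 2 < n := fun i => by
    have := i.2
    omega
  -- Around the cycle, position `2 * i` is the variable `x_i` and position `2 * i + 1` the clause
  -- `x_i ∨ x_{i+1}`.
  let f : Fin (2 * n) → ↥(vars (cycle n)) ⊕ {C // C ∈ cycle n} := fun i =>
    if i.1 % 2 = 0 then Sum.inl ⟨i.1 / 2, mem_vars_cycle.2 (hdiv i)⟩
    else Sum.inr ⟨_, mem_cycle.2 ⟨⟨i.1 / 2, hdiv i⟩, rfl⟩⟩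
  have hf₀ : ∀ i : Fin (2 * n), i.1 % 2 = 0 →
      f i = Sum.inl ⟨i.1 / 2, mem_vars_cycle.2 (hdiv i)⟩ := fun i h => if_pos h
  have hf₁ : ∀ i : Fin (2 * n), ¬ i.1 % 2 = 0 →
      f i = Sum.inr ⟨_, mem_cycle.2 ⟨⟨i.1 / 2, hdiv i⟩, rfl⟩⟩ := fun i h => if_neg h
  have hf : Function.Bijective f := by
    constructor
    · intro i j hij
      by_cases hi : i.1 % 2 = 0 <;> by_cases hj : j.1 % 2 = 0
      · rw [hf₀ i hi, hf₀ j hj, Sum.inl.injEq, Subtype.mk.injEq] at hij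
        exact Fin.ext (by omega)
      · rw [hf₀ i hi, hf₁ j hj] at hij
        cases hij
      · rw [hf₁ i hi, hf₀ j hj] at hij
        cases hij
      · rw [hf₁ i hi, hf₁ j hj, Sum.inr.injEq, Subtype.mk.injEq] at hij
        have := Fin.mk.inj (eq_of_clauseVars_cycleClause_eq hn (congrArg clauseVars hij))
        exact Fin.ext (by omega)
    · rintro (⟨x, hx⟩ | ⟨C, hC⟩)
      · have := mem_vars_cycle.1 hx
        refine ⟨⟨2 * x, by omega⟩, (hf₀ _ (by simp)).trans ?_⟩
        simp
      · obtain ⟨i, rfl⟩ := mem_cycle.1 hC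
        refine ⟨⟨2 * i.1 + 1, by omega⟩, (hf₁ _ (by simp [Nat.add_mod])).trans ?_⟩
        congr 3
        exact Fin.ext (by simp; omega)
  refine cliqueWidthLE_of_cycle hk (N := 2 * n) (by omega) (Equiv.ofBijective f hf)
    fun i j hij => ?_
  rw [Fin.lt_def] at hij
  rw [Equiv.ofBijective_apply, Equiv.ofBijective_apply]
  by_cases hi : i.1 % 2 = 0 <;> by_cases hj : j.1 % 2 = 0
  · rw [hf₀ i hi, hf₀ j hj]
    refine iff_of_false ?_ (by omega)
    simp [incidenceGraph]
  · rw [hf₀ i hi, hf₁ j hj, incidenceGraph_adj_inl_inr, mem_clauseVars_cycleClause,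
      succ_mod_eq (hdiv j)]
    dsimp only
    have := j.2
    split_ifs <;> omega
  · rw [hf₁ i hi, hf₀ j hj, SimpleGraph.adj_comm, incidenceGraph_adj_inl_inr,
      mem_clauseVars_cycleClause, succ_mod_eq (hdiv i)]
    dsimp only
    have := j.2
    split_ifs <;> omega
  · rw [hf₁ i hi, hf₁ j hj]
    refine iff_of_false ?_ (by omega)
    simp [incidenceGraph]

/-- The edge of the cycle hypergraph given by a clause of the cycle formula. -/
def cycleEdge {n : ℕ} (i : Fin n) : ↥(hypergraph (cycle n)).edgeSet :=
  ⟨clauseVars (cycleClause i), _, mem_cycle.2 ⟨i, rfl⟩, rfl⟩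

theorem cycleEdge_injective {n : ℕ} (hn : 3 ≤ n) :
    Function.Injective (cycleEdge (n := n)) :=
  fun _ _ h => eq_of_clauseVars_cycleClause_eq hn (Subtype.ext_iff.1 h)

theorem cycleEdge_surjective {n : ℕ} : Function.Surjective (cycleEdge (n := n)) := by
  rintro ⟨_, C, hC, rfl⟩
  obtain ⟨i, rfl⟩ := mem_cycle.1 hC
  exact ⟨i, rfl⟩

/-- Consecutive edges of the cycle are adjacent in each join tree: no other edge contains their
common vertex. -/
theorem adj_cycleEdge_of_isJoinTree {n : ℕ} (hn : 3 ≤ n)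
    {T : SimpleGraph ↥(hypergraph (cycle n)).edgeSet}
    (hT : (hypergraph (cycle n)).IsJoinTree T) {i j : Fin n} (hij : j.1 = (i.1 + 1) % n) :
    T.Adj (cycleEdge i) (cycleEdge j) := by
  have hi : j.1 ∈ (cycleEdge i).1 := mem_clauseVars_cycleClause.2 (Or.inr hij)
  have hj : j.1 ∈ (cycleEdge j).1 := mem_clauseVars_cycleClause.2 (Or.inl rfl)
  have hne : i ≠ j := by
    rintro rfl
    rw [succ_mod_eq i.2] at hij
    split_ifs at hij <;> omega
  -- The first step of a walk among the hyperedges containing `j` leaves hyperedge `i`, and the only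
  -- other such hyperedge is `j` itself.
  obtain ⟨p⟩ := hT.2 j.1 (mem_vars_cycle.2 j.2) ⟨cycleEdge i, hi⟩ ⟨cycleEdge j, hj⟩
  obtain ⟨⟨t, ht⟩, h, -, -⟩ := p.exists_eq_cons_of_ne
    fun h => hne (cycleEdge_injective hn (Subtype.ext_iff.1 h))
  obtain ⟨l, rfl⟩ := cycleEdge_surjective t
  have hadj : T.Adj (cycleEdge i) (cycleEdge l) := h
  have hil : i ≠ l := fun h => hadj.ne (congrArg _ h)
  have hjl := mem_clauseVars_cycleClause.1 ht
  have : j = l := by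
    rw [succ_mod_eq i.2] at hij
    rw [succ_mod_eq l.2] at hjl
    rw [ne_eq, Fin.ext_iff] at hil
    refine Fin.ext ?_
    split_ifs at hij hjl <;> omega
  exact this ▸ hadj

/-- The edge from the last hyperedge to the first would be a bridge, but the remaining consecutive
adjacencies connect its ends the other way round. -/
theorem not_isJoinTree_cycle {n : ℕ} (hn : 3 ≤ n)
    (T : SimpleGraph ↥(hypergraph (cycle n)).edgeSet) :
    ¬ (hypergraph (cycle n)).IsJoinTree T := by
  intro hT
  have hlast : T.Adj (cycleEdge ⟨n - 1, by omega⟩) (cycleEdge ⟨0, by omega⟩) :=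
    adj_cycleEdge_of_isJoinTree hn hT (by simp [Nat.sub_add_cancel (show 1 ≤ n by omega)])
  have hbridge := SimpleGraph.isAcyclic_iff_forall_adj_isBridge.1 hT.1.isAcyclic hlast
  rw [SimpleGraph.isBridge_iff] at hbridge
  have key : ∀ i (hi : i < n), (T.deleteEdges {s(cycleEdge ⟨n - 1, by omega⟩,
      cycleEdge ⟨0, by omega⟩)}).Reachable (cycleEdge ⟨0, by omega⟩) (cycleEdge ⟨i, hi⟩) := by
    intro i
    induction i with
    | zero => exact fun _ => SimpleGraph.Reachable.refl _
    | succ i ih =>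
      intro hi
      refine (ih (by omega)).trans (SimpleGraph.Adj.reachable ?_)
      rw [SimpleGraph.deleteEdges_adj]
      refine ⟨adj_cycleEdge_of_isJoinTree hn hT (Nat.mod_eq_of_lt hi).symm, ?_⟩
      simp only [Set.mem_singleton_iff, Sym2.eq_iff, (cycleEdge_injective hn).eq_iff,
        Fin.mk.injEq]
      omega
  exact hbridge (key (n - 1) (by omega)).symm

theorem boundedIncidenceCliqueWidth_cycleClass : BoundedIncidenceCliqueWidth cycleClass := by
  refine ⟨4, ?_⟩
  rintro _ ⟨n, hn, rfl⟩
  exact incidenceCliqueWidthLE_cycle le_rfl hn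

theorem cycle_notMem_disjointBranchesClass {n : ℕ} (hn : 3 ≤ n) :
    cycle n ∉ disjointBranchesClass :=
  fun ⟨T, _, hT⟩ => not_isJoinTree_cycle hn T hT.1

theorem not_boundedIncidenceCliqueWidth_disjointBranchesClass :
    ¬ BoundedIncidenceCliqueWidth disjointBranchesClass := fun ⟨k, hk⟩ =>
  not_boundedIncidenceCliqueWidth_joinPathClass
    ⟨k, fun F hF => hk F (joinPathClass_subset_disjointBranchesClass hF)⟩

end CNFFormula

theorem mainTheorem6 :
    -- formulas with join paths have unbounded incidence clique-width
    ¬ CNFFormula.BoundedIncidenceCliqueWidth CNFFormula.joinPathClass ∧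
    -- formulas with join paths have disjoint branches decompositions
    CNFFormula.joinPathClass ⊆ CNFFormula.disjointBranchesClass ∧
    -- formulas with disjoint branches decompositions have unbounded incidence clique-width
    ¬ CNFFormula.BoundedIncidenceCliqueWidth CNFFormula.disjointBranchesClass ∧
    -- cycles have bounded incidence clique-width but no disjoint branches decompositions
    CNFFormula.BoundedIncidenceCliqueWidth CNFFormula.cycleClass ∧
    (∀ F ∈ CNFFormula.cycleClass, F ∉ CNFFormula.disjointBranchesClass) ∧
    -- the disjoint branches class is incomparable with bounded incidence clique-width
    ∃ k₀, ∀ k ≥ k₀,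
      ¬ CNFFormula.disjointBranchesClass ⊆ CNFFormula.cliqueWidthClass k ∧
      ¬ CNFFormula.cliqueWidthClass k ⊆ CNFFormula.disjointBranchesClass := by
  refine ⟨CNFFormula.not_boundedIncidenceCliqueWidth_joinPathClass,
    CNFFormula.joinPathClass_subset_disjointBranchesClass,
    CNFFormula.not_boundedIncidenceCliqueWidth_disjointBranchesClass,
    CNFFormula.boundedIncidenceCliqueWidth_cycleClass, ?_, 4, fun k hk => ⟨?_, ?_⟩⟩
  · rintro _ ⟨n, hn, rfl⟩
    exact CNFFormula.cycle_notMem_disjointBranchesClass hn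
  · exact fun h => CNFFormula.not_boundedIncidenceCliqueWidth_disjointBranchesClass ⟨k, h⟩
  -- The witness is `C_3`; the bound `4` is the number of labels used for cycles.
  · exact fun h => CNFFormula.cycle_notMem_disjointBranchesClass le_rfl
      (h (CNFFormula.incidenceCliqueWidthLE_cycle hk le_rfl))
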